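/- Let $n\ge 1$ and $\tau(n)=\left(1+\frac1n\right)(H_{n+1}-1)$, where $H_m=\sum_{k=1}^m \frac1k$. An instance $\mathcal I$ of size $n$ of online minimum bipartite matching under the uniform metric consists of two disjoint sets $L$ and $R$ of $n$ labelled points each and a (pseudo)metric $d$ on $L\cup R$ that takes only the values $0$ and $1$ (distinct points may be colocated). The points of $L$ are known in advance; the points of $R$ arrive one at a time in a uniformly random order. When $j\in R$ arrives, its distances to $L$ and to the points that arrived before are revealed, and an online algorithm must irrevocably match $j$ to a still unmatched $i\in L$ at cost $d(i,j)$. Its decisions depend only on what has been revealed so far and, if the algorithm is randomized, on its own randomness, which is independent of the arrival order. Let $\mathrm{ALG}(\mathcal I)$ be the expected total cost, over the random arrival order and the randomness of the algorithm, let $\mathrm{OPT}(\mathcal I)$ be the minimum cost of a perfect matching between $L$ and $R$, and let the competitive ratio of the algorithm on instances of size $n$ be $$\mathsf{CR}(\mathrm{ALG})=\sup_{\mathcal I}\frac{\mathrm{ALG}(\mathcal I)}{\mathrm{OPT}(\mathcal I)}\in[0,\infty],$$ the supremum being over all instances of size $n$, with the conventions $0/0=0$ and $a/0=\infty$ for $a>0$.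 Then every online algorithm, deterministic or randomized, satisfies $\mathsf{CR}(\mathrm{ALG})\ge\tau(n)$. -/

import Mathlib

open scoped BigOperators ENNReal

noncomputable section

namespace OnlineMatching

/-- An instance of size `n` of online minimum bipartite matching under the uniform metric.
The points of `L` (known in advance) are the `Sum.inl i`, those of `R` (arriving online) the
`Sum.inr j`. The distance is a (pseudo)metric on the disjoint union of `L` and `R` which takes
only the values `0` and `1`; distinct points may be colocated, that is, at distance `0`. -/
structure UniformInstance (n : ℕ) where
  d : Fin n ⊕ Fin n → Fin n ⊕ Fin n → ℝ
  d_self : ∀ x, d x x = 0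
  d_comm : ∀ x y, d x y = d y x
  d_triangle : ∀ x y z, d x z ≤ d x y + d y z
  d_binary : ∀ x y, d x y = 0 ∨ d x y = 1

/-- The points known to an algorithm in round `t` when the arrival order is `σ` (the point
arriving in round `s` is `σ s`): all of `L`, and the points of `R` that arrived up to and
including round `t`. -/
def knownPoints {n : ℕ} (σ : Equiv.Perm (Fin n)) (t : Fin n) : Set (Fin n ⊕ Fin n) :=
  {x | (∃ i, x = Sum.inl i) ∨ ∃ s, s ≤ t ∧ x = Sum.inr (σ s)}

/-- A deterministic online algorithm for instances of size `n`: `assign I σ t` is the point of `L`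
to which the point arriving in round `t` is matched. Each point of `L` is used at most once, and
the decision of round `t` depends only on what has been revealed: which points arrived in the
rounds `s ≤ t` and in which order, and the distances among all known points. -/
structure OnlineAlgorithm (n : ℕ) where
  assign : UniformInstance n → Equiv.Perm (Fin n) → Fin n → Fin n
  assign_injective : ∀ I σ, Function.Injective (assign I σ)
  online : ∀ (I I' : UniformInstance n) (σ σ' : Equiv.Perm (Fin n)) (t : Fin n),
    (∀ s, s ≤ t → σ s = σ' s) →
    (∀ x ∈ knownPoints σ t, ∀ y ∈ knownPoints σ t, I.d x y = I'.d x y) →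
    assign I σ t = assign I' σ' t

/-- Total cost of the matching produced on instance `I` with arrival order `σ`. -/
def OnlineAlgorithm.cost {n : ℕ} (D : OnlineAlgorithm n) (I : UniformInstance n)
    (σ : Equiv.Perm (Fin n)) : ℝ :=
  ∑ t, I.d (Sum.inl (D.assign I σ t)) (Sum.inr (σ t))

/-- Expected cost under random-order arrivals: the average over all arrival orders. -/
def OnlineAlgorithm.expectedCost {n : ℕ} (D : OnlineAlgorithm n) (I : UniformInstance n) : ℝ :=
  (∑ σ : Equiv.Perm (Fin n), D.cost I σ) / (Fintype.card (Equiv.Perm (Fin n)) : ℝ)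

/-- A randomized online algorithm with random seeds in `Ω`: a seed is drawn from the probability
measure `law`, independently of the arrival order, and fixes a deterministic online algorithm,
each decision being a measurable function of the seed. -/
structure RandomizedAlgorithm (n : ℕ) (Ω : Type*) [MeasurableSpace Ω] where
  law : MeasureTheory.Measure Ω
  isProbabilityMeasure_law : MeasureTheory.IsProbabilityMeasure law
  run : Ω → OnlineAlgorithm n
  measurable_run : ∀ I σ t, Measurable fun ω => (run ω).assign I σ t

/-- Expected cost of a randomized algorithm, over both its seed and the random arrival order. -/
def RandomizedAlgorithm.expectedCost {n : ℕ} {Ω : Type*} [MeasurableSpace Ω]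
    (A : RandomizedAlgorithm n Ω) (I : UniformInstance n) : ℝ :=
  ∫ ω, (A.run ω).expectedCost I ∂A.law

/-- Offline optimum: minimum cost of a perfect matching between `L` and `R`. It does not depend
on the arrival order. -/
def opt {n : ℕ} (I : UniformInstance n) : ℝ :=
  Finset.univ.inf' Finset.univ_nonempty
    fun π : Equiv.Perm (Fin n) => ∑ j, I.d (Sum.inl (π j)) (Sum.inr j)

/-- Competitive ratio, on instances of size `n`, of an algorithm with expected costs `c`: the
supremum over all instances of `c I / opt I` in `[0, ∞]`, where `0 / 0 = 0` and `a / 0 = ∞` for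
`a > 0`. -/
def competitiveRatio {n : ℕ} (c : UniformInstance n → ℝ) : ℝ≥0∞ :=
  ⨆ I : UniformInstance n, ENNReal.ofReal (c I) / ENNReal.ofReal (opt I)

/-- `τ(n) = (1 + 1/n) (H_{n+1} - 1)`. -/
def tau (n : ℕ) : ℝ := (1 + 1 / (n : ℝ)) * ((harmonic (n + 1) : ℝ) - 1)

end OnlineMatching

end

/-!
Put the `n` points of `L` at `n` distinct places, add one further place, and let the `n` requests
occupy all but one of the `n + 1` places, according to a uniformly random permutation of the
places. Fix the arrival order and a deterministic algorithm. Before round `t` (counted from `0`)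
there are `n + 1 - t` places that no request has revealed, equally likely to be the next one
requested, while only `n - t` points of `L` are free. Hence round `t` costs `1` with probability at
least `1 / (n + 1 - t)`, and the expected total cost is at least `H_{n+1} - 1`; this survives
averaging over the arrival order and, as in Yao's principle, over the seed of a randomized
algorithm. The optimum is `0` if the empty place is the additional one and at most `1` otherwise, so
its expectation is at most `n / (n + 1)`. The ratio of the two bounds is `τ(n)`, and some instance
is at least as bad as the ratio of the expectations.
-/

namespace OnlineMatching

open Finset Equiv MeasureTheory
open scoped Nat

theorem card_le_card_mul_sum_of_forall_exists_one_le {G ι R : Type*} [Group G] [Fintype G]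
    [Semiring R] [PartialOrder R] [IsOrderedRing R] {s : Finset ι} {x : ι → G} {f : G → R}
    (hf : ∀ g, 0 ≤ f g) (h : ∀ g, ∃ i ∈ s, 1 ≤ f (g * x i)) :
    (Fintype.card G : R) ≤ #s * ∑ g, f g := by
  have one_le_sum (g : G) : 1 ≤ ∑ i ∈ s, f (g * x i) := by
    obtain ⟨i, hi, hfi⟩ := h g
    exact hfi.trans (single_le_sum (f := fun i => f (g * x i)) (fun _ _ => hf _) hi)
  calc (Fintype.card G : R) = ∑ _g : G, 1 := by simp
    _ ≤ ∑ g, ∑ i ∈ s, f (g * x i) := sum_le_sum fun g _ => one_le_sum g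
    _ = ∑ i ∈ s, ∑ g, f (g * x i) := sum_comm
    _ = ∑ _i ∈ s, ∑ g, f g := sum_congr rfl fun i _ => Equiv.sum_comp (Equiv.mulRight (x i)) f
    _ = #s * ∑ g, f g := by rw [sum_const, nsmul_eq_mul]

theorem sum_inv_succ_sub_eq_harmonic_sub_one (n : ℕ) :
    ∑ t : Fin n, ((n + 1 - t : ℕ) : ℚ)⁻¹ = harmonic (n + 1) - 1 := by
  have succ_sub_rev (t : Fin n) : n + 1 - (t.rev : ℕ) = t + 1 + 1 := by
    rw [Fin.val_rev]
    omega
  rw [← Equiv.sum_comp Fin.revPerm, harmonic, sum_range_succ']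
  simp only [Fin.revPerm_apply, succ_sub_rev]
  rw [Fin.sum_univ_eq_sum_range fun t => ((t + 1 + 1 : ℕ) : ℚ)⁻¹]
  simp

variable {n : ℕ} {ι : Type*}

namespace UniformInstance

theorem d_nonneg (I : UniformInstance n) (x y : Fin n ⊕ Fin n) : 0 ≤ I.d x y := by
  rcases I.d_binary x y with h | h <;> simp [h]

theorem d_le_one (I : UniformInstance n) (x y : Fin n ⊕ Fin n) : I.d x y ≤ 1 := by
  rcases I.d_binary x y with h | h <;> simp [h]

/-- The instance whose points lie at the places `loc` of a space with the discrete metric. -/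
def ofLocation {α : Type*} [DecidableEq α] (loc : Fin n ⊕ Fin n → α) : UniformInstance n where
  d x y := if loc x = loc y then 0 else 1
  d_self x := if_pos rfl
  d_comm x y := by simp only [eq_comm]
  d_triangle x y z := by grind
  d_binary x y := by split_ifs <;> simp

end UniformInstance

theorem opt_nonneg (I : UniformInstance n) : 0 ≤ opt I :=
  le_inf' _ _ fun _ _ => sum_nonneg fun _ _ => I.d_nonneg _ _

theorem le_toReal_competitiveRatio_mul_opt {c : UniformInstance n → ℝ}
    (hc : competitiveRatio c ≠ ∞) (I : UniformInstance n) :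
    c I ≤ (competitiveRatio c).toReal * opt I := by
  have ratio_le : ENNReal.ofReal (c I) / ENNReal.ofReal (opt I) ≤ competitiveRatio c :=
    le_iSup (fun I => ENNReal.ofReal (c I) / ENNReal.ofReal (opt I)) I
  rw [← ENNReal.ofReal_le_ofReal_iff (mul_nonneg ENNReal.toReal_nonneg (opt_nonneg I)),
    ENNReal.ofReal_mul ENNReal.toReal_nonneg, ENNReal.ofReal_toReal hc]
  exact (ENNReal.div_le_iff_le_mul (.inr hc) (.inl ENNReal.ofReal_ne_top)).mp ratio_le

-- If `b = 0`, the left-hand side is `0` because of `a / 0 = 0`.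
theorem ofReal_div_le_competitiveRatio {c : UniformInstance n → ℝ} {s : Finset ι}
    {I : ι → UniformInstance n} {a b : ℝ} (ha : a ≤ ∑ i ∈ s, c (I i))
    (hb : ∑ i ∈ s, opt (I i) ≤ b) : ENNReal.ofReal (a / b) ≤ competitiveRatio c := by
  by_cases hc : competitiveRatio c = ∞
  · simp only [hc, le_top]
  refine ENNReal.ofReal_le_of_le_toReal (div_le_of_le_mul₀
    ((sum_nonneg fun i _ => opt_nonneg (I i)).trans hb) ENNReal.toReal_nonneg ?_)
  calc a ≤ ∑ i ∈ s, c (I i) := ha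
    _ ≤ ∑ i ∈ s, (competitiveRatio c).toReal * opt (I i) :=
      sum_le_sum fun i _ => le_toReal_competitiveRatio_mul_opt hc (I i)
    _ = (competitiveRatio c).toReal * ∑ i ∈ s, opt (I i) := (mul_sum ..).symm
    _ ≤ (competitiveRatio c).toReal * b := by gcongr

namespace OnlineAlgorithm

/-- The cost incurred by `D` in round `t`. -/
def roundCost (D : OnlineAlgorithm n) (I : UniformInstance n) (σ : Perm (Fin n)) (t : Fin n) : ℝ :=
  I.d (Sum.inl (D.assign I σ t)) (Sum.inr (σ t))

theorem roundCost_nonneg (D : OnlineAlgorithm n) (I : UniformInstance n) (σ : Perm (Fin n))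
    (t : Fin n) : 0 ≤ D.roundCost I σ t :=
  I.d_nonneg _ _

theorem roundCost_le_one (D : OnlineAlgorithm n) (I : UniformInstance n) (σ : Perm (Fin n))
    (t : Fin n) : D.roundCost I σ t ≤ 1 :=
  I.d_le_one _ _

/-- The points of `L` that are no longer free when the request of round `t` arrives. -/
def matchedBefore (D : OnlineAlgorithm n) (I : UniformInstance n) (σ : Perm (Fin n)) (t : Fin n) :
    Finset (Fin n) :=
  (Iio t).image (D.assign I σ)

theorem card_matchedBefore (D : OnlineAlgorithm n) (I : UniformInstance n) (σ : Perm (Fin n))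
    (t : Fin n) : #(D.matchedBefore I σ t) = t := by
  rw [matchedBefore, card_image_of_injective _ (D.assign_injective I σ), Fin.card_Iio]

theorem assign_notMem_matchedBefore (D : OnlineAlgorithm n) (I : UniformInstance n)
    (σ : Perm (Fin n)) (t : Fin n) : D.assign I σ t ∉ D.matchedBefore I σ t := by
  rw [matchedBefore, (D.assign_injective I σ).mem_finset_image, mem_Iio]
  exact lt_irrefl t

theorem assign_ofLocation_congr (D : OnlineAlgorithm n) {α : Type*} [DecidableEq α]
    {loc loc' : Fin n ⊕ Fin n → α} {σ : Perm (Fin n)} {t : Fin n}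
    (h : ∀ x ∈ knownPoints σ t, loc x = loc' x) :
    D.assign (.ofLocation loc) σ t = D.assign (.ofLocation loc') σ t :=
  D.online _ _ σ σ t (fun _ _ => rfl) fun x hx y hy => by
    simp only [UniformInstance.ofLocation, h x hx, h y hy]

theorem le_sum_expectedCost (D : OnlineAlgorithm n) {s : Finset ι} {I : ι → UniformInstance n}
    {a : ℝ} (h : ∀ σ, a ≤ ∑ i ∈ s, D.cost (I i) σ) : a ≤ ∑ i ∈ s, D.expectedCost (I i) := by
  simp only [expectedCost]
  rw [← sum_div, le_div_iff₀ (by exact_mod_cast Fintype.card_pos), sum_comm, mul_comm,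
    ← nsmul_eq_mul]
  exact card_nsmul_le_sum _ _ _ fun σ _ => h σ

end OnlineAlgorithm

namespace RandomizedAlgorithm

variable {Ω : Type*} [MeasurableSpace Ω]

theorem integrable_roundCost (A : RandomizedAlgorithm n Ω) (I : UniformInstance n)
    (σ : Perm (Fin n)) (t : Fin n) :
    Integrable (fun ω => (A.run ω).roundCost I σ t) A.law := by
  have := A.isProbabilityMeasure_law
  have measurable_roundCost : Measurable fun ω => (A.run ω).roundCost I σ t :=
    (measurable_of_finite fun i : Fin n => I.d (Sum.inl i) (Sum.inr (σ t))).comp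
      (A.measurable_run I σ t)
  refine .of_bound measurable_roundCost.aestronglyMeasurable 1 (.of_forall fun ω => ?_)
  rw [Real.norm_of_nonneg ((A.run ω).roundCost_nonneg I σ t)]
  exact (A.run ω).roundCost_le_one I σ t

theorem integrable_expectedCost (A : RandomizedAlgorithm n Ω) (I : UniformInstance n) :
    Integrable (fun ω => (A.run ω).expectedCost I) A.law :=
  (integrable_finsetSum _ fun σ _ =>
    integrable_finsetSum _ fun t _ => A.integrable_roundCost I σ t).div_const _

theorem le_sum_expectedCost (A : RandomizedAlgorithm n Ω) {s : Finset ι}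
    {I : ι → UniformInstance n} {a : ℝ}
    (h : ∀ D : OnlineAlgorithm n, a ≤ ∑ i ∈ s, D.expectedCost (I i)) :
    a ≤ ∑ i ∈ s, A.expectedCost (I i) := by
  have := A.isProbabilityMeasure_law
  calc a = ∫ _, a ∂A.law := by simp
    _ ≤ ∫ ω, ∑ i ∈ s, (A.run ω).expectedCost (I i) ∂A.law :=
      integral_mono (integrable_const a)
        (integrable_finsetSum s fun i _ => A.integrable_expectedCost (I i)) fun ω => h (A.run ω)
    _ = ∑ i ∈ s, A.expectedCost (I i) :=
      integral_finsetSum s fun i _ => A.integrable_expectedCost (I i)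

end RandomizedAlgorithm

/-- The hard instance given by a permutation `ρ` of the `n + 1` places `Option (Fin n)`: the point
`i` of `L` lies at `some i`, no point of `L` lies at `none`, the request `j` lies at `ρ (some j)`,
and no request lies at `ρ none`. -/
def hardInstance (ρ : Perm (Option (Fin n))) : UniformInstance n :=
  .ofLocation (Sum.elim some (ρ ∘ some))

theorem hardInstance_d_inl_inr (ρ : Perm (Option (Fin n))) (i j : Fin n) :
    (hardInstance ρ).d (Sum.inl i) (Sum.inr j) = if some i = ρ (some j) then 0 else 1 :=
  rfl

theorem opt_hardInstance_le (ρ : Perm (Option (Fin n))) :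
    opt (hardInstance ρ) ≤ if ρ none = none then 0 else 1 := by
  -- `removeNone ρ` matches each request to the point of `L` at its place, except that a request at
  -- `none` is matched to the point at `ρ none`.
  have d_removeNone_le (j : Fin n) : (hardInstance ρ).d (Sum.inl (removeNone ρ j)) (Sum.inr j) ≤
      if ρ (some j) = none then 1 else 0 := by
    by_cases hj : ρ (some j) = none
    · simpa only [hj, if_true] using UniformInstance.d_le_one _ _ _
    · rw [hardInstance_d_inl_inr, if_neg hj,
        if_pos (removeNone_some ρ (Option.ne_none_iff_exists'.mp hj))]
  have sum_eq_one : ∑ a, (if ρ a = none then (1 : ℝ) else 0) = 1 := by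
    rw [Equiv.sum_comp ρ fun b => if b = none then (1 : ℝ) else 0]
    simp
  calc opt (hardInstance ρ)
      ≤ ∑ j, (hardInstance ρ).d (Sum.inl (removeNone ρ j)) (Sum.inr j) :=
        inf'_le _ (mem_univ _)
    _ ≤ ∑ j, if ρ (some j) = none then 1 else 0 := sum_le_sum fun j _ => d_removeNone_le j
    _ = if ρ none = none then 0 else 1 := by
        rw [Fintype.sum_option] at sum_eq_one
        split_ifs at sum_eq_one ⊢ <;> linarith

theorem sum_opt_hardInstance_le (n : ℕ) :
    ∑ ρ : Perm (Option (Fin n)), opt (hardInstance ρ) ≤ n * n ! := by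
  calc ∑ ρ : Perm (Option (Fin n)), opt (hardInstance ρ)
      ≤ ∑ ρ : Perm (Option (Fin n)), if ρ none = none then 0 else 1 :=
        sum_le_sum fun ρ _ => opt_hardInstance_le ρ
    _ = ∑ p : Option (Fin n) × Perm (Fin n), if p.1 = none then 0 else 1 :=
        Equiv.sum_comp Perm.decomposeOption
          fun p : Option (Fin n) × Perm (Fin n) => if p.1 = none then (0 : ℝ) else 1
    _ = n * n ! := by simp [Fintype.sum_prod_type, Fintype.card_perm]

/-- The labels `a` for which the place `ρ a` in `hardInstance ρ` is not revealed before round `t`;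
they include `none`, the label of the place without a request. -/
def pendingLabels (σ : Perm (Fin n)) (t : Fin n) : Finset (Option (Fin n)) :=
  ((Iio t).map (σ.toEmbedding.trans .some))ᶜ

theorem mem_pendingLabels {σ : Perm (Fin n)} {t : Fin n} {a : Option (Fin n)} :
    a ∈ pendingLabels σ t ↔ ∀ s < t, some (σ s) ≠ a := by
  simp [pendingLabels]

theorem card_pendingLabels (σ : Perm (Fin n)) (t : Fin n) : #(pendingLabels σ t) = n + 1 - t := by
  simp [pendingLabels, card_compl]

theorem apply_swap_eq_of_mem_pendingLabels {σ : Perm (Fin n)} {s t : Fin n} {a : Option (Fin n)}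
    (ρ : Perm (Option (Fin n))) (ha : a ∈ pendingLabels σ t) (hs : s < t) :
    (ρ * swap (some (σ t)) a) (some (σ s)) = ρ (some (σ s)) := by
  have ne_current : some (σ s) ≠ some (σ t) := by simpa using hs.ne
  rw [Perm.mul_apply, swap_apply_of_ne_of_ne ne_current (mem_pendingLabels.mp ha s hs)]

namespace OnlineAlgorithm

variable (D : OnlineAlgorithm n) (σ : Perm (Fin n)) (t : Fin n)

theorem matchedBefore_hardInstance_congr {ρ ρ' : Perm (Option (Fin n))}
    (h : ∀ s < t, ρ (some (σ s)) = ρ' (some (σ s))) :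
    D.matchedBefore (hardInstance ρ) σ t = D.matchedBefore (hardInstance ρ') σ t := by
  refine image_congr fun r hr => D.assign_ofLocation_congr ?_
  rintro x (⟨i, rfl⟩ | ⟨s, hsr, rfl⟩)
  · rfl
  · exact h s (hsr.trans_lt (mem_Iio.mp hr))

theorem roundCost_hardInstance_eq_one {ρ : Perm (Option (Fin n))}
    (h : ρ (some (σ t)) ∈ insertNone (D.matchedBefore (hardInstance ρ) σ t)) :
    D.roundCost (hardInstance ρ) σ t = 1 := by
  refine if_neg fun assign_eq : some _ = ρ (some (σ t)) => ?_
  rw [← assign_eq, some_mem_insertNone] at h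
  exact D.assign_notMem_matchedBefore _ σ t h

theorem exists_mem_pendingLabels_apply_mem_insertNone (ρ : Perm (Option (Fin n))) :
    ∃ a ∈ pendingLabels σ t, ρ a ∈ insertNone (D.matchedBefore (hardInstance ρ) σ t) := by
  have card_lt : #(univ : Finset (Option (Fin n))) <
      #((pendingLabels σ t).map ρ.toEmbedding) +
        #(insertNone (D.matchedBefore (hardInstance ρ) σ t)) := by
    rw [card_map, card_pendingLabels, card_insertNone, card_matchedBefore, Finset.card_univ,
      Fintype.card_option, Fintype.card_fin]
    omega
  obtain ⟨b, hb⟩ :=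
    inter_nonempty_of_card_lt_card_add_card (subset_univ _) (subset_univ _) card_lt
  obtain ⟨hb_pending, hb_matched⟩ := mem_inter.mp hb
  obtain ⟨a, ha, rfl⟩ := mem_map.mp hb_pending
  exact ⟨a, ha, hb_matched⟩

theorem exists_mem_pendingLabels_roundCost_eq_one (ρ : Perm (Option (Fin n))) :
    ∃ a ∈ pendingLabels σ t,
      D.roundCost (hardInstance (ρ * swap (some (σ t)) a)) σ t = 1 := by
  obtain ⟨a, ha, hρa⟩ := D.exists_mem_pendingLabels_apply_mem_insertNone σ t ρ
  refine ⟨a, ha, D.roundCost_hardInstance_eq_one σ t ?_⟩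
  rwa [D.matchedBefore_hardInstance_congr σ t fun s => apply_swap_eq_of_mem_pendingLabels ρ ha,
    Perm.mul_apply, swap_apply_left]

theorem factorial_mul_inv_le_sum_roundCost :
    ((n + 1)! : ℝ) * ((n + 1 - t : ℕ) : ℝ)⁻¹ ≤
      ∑ ρ : Perm (Option (Fin n)), D.roundCost (hardInstance ρ) σ t := by
  have card_le := card_le_card_mul_sum_of_forall_exists_one_le
    (f := fun ρ => D.roundCost (hardInstance ρ) σ t) (fun _ => D.roundCost_nonneg _ σ t)
    fun ρ => (D.exists_mem_pendingLabels_roundCost_eq_one σ t ρ).imp fun _ h => ⟨h.1, h.2.ge⟩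
  rw [Fintype.card_perm, Fintype.card_option, Fintype.card_fin, card_pendingLabels] at card_le
  have rounds_left_pos : 0 < n + 1 - (t : ℕ) := by omega
  rwa [mul_inv_le_iff₀' (by exact_mod_cast rounds_left_pos)]

theorem factorial_mul_harmonic_le_sum_cost :
    ((n + 1)! : ℝ) * (harmonic (n + 1) - 1) ≤
      ∑ ρ : Perm (Option (Fin n)), D.cost (hardInstance ρ) σ := by
  have sum_inv : ∑ t : Fin n, ((n + 1 - t : ℕ) : ℝ)⁻¹ = (harmonic (n + 1) : ℝ) - 1 := by
    simpa using congrArg (Rat.cast : ℚ → ℝ) (sum_inv_succ_sub_eq_harmonic_sub_one n)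
  calc ((n + 1)! : ℝ) * (harmonic (n + 1) - 1)
      = ∑ t : Fin n, ((n + 1)! : ℝ) * ((n + 1 - t : ℕ) : ℝ)⁻¹ := by rw [← sum_inv, mul_sum]
    _ ≤ ∑ t, ∑ ρ : Perm (Option (Fin n)), D.roundCost (hardInstance ρ) σ t :=
      sum_le_sum fun t _ => D.factorial_mul_inv_le_sum_roundCost σ t
    _ = ∑ ρ : Perm (Option (Fin n)), D.cost (hardInstance ρ) σ := sum_comm

end OnlineAlgorithm

theorem factorial_mul_harmonic_div_eq_tau (hn : n ≠ 0) :
    ((n + 1)! : ℝ) * (harmonic (n + 1) - 1) / (n * n !) = tau n := by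
  rw [tau, Nat.factorial_succ]
  push_cast
  field_simp

theorem tau_le_competitiveRatio (hn : n ≠ 0) {c : UniformInstance n → ℝ}
    (hc : ((n + 1)! : ℝ) * (harmonic (n + 1) - 1) ≤
      ∑ ρ : Perm (Option (Fin n)), c (hardInstance ρ)) :
    ENNReal.ofReal (tau n) ≤ competitiveRatio c := by
  rw [← factorial_mul_harmonic_div_eq_tau hn]
  exact ofReal_div_le_competitiveRatio hc (sum_opt_hardInstance_le n)

end OnlineMatching

theorem theorem2 (n : ℕ) (hn : 1 ≤ n) :
    (∀ D : OnlineMatching.OnlineAlgorithm n,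
      ENNReal.ofReal (OnlineMatching.tau n) ≤
        OnlineMatching.competitiveRatio D.expectedCost) ∧
    (∀ (Ω : Type*) [MeasurableSpace Ω] (A : OnlineMatching.RandomizedAlgorithm n Ω),
      ENNReal.ofReal (OnlineMatching.tau n) ≤
        OnlineMatching.competitiveRatio A.expectedCost) := by
  have hn₀ : n ≠ 0 := Nat.one_le_iff_ne_zero.mp hn
  have deterministic_bound (D : OnlineMatching.OnlineAlgorithm n) :
      ((n + 1).factorial : ℝ) * (harmonic (n + 1) - 1) ≤
        ∑ ρ, D.expectedCost (OnlineMatching.hardInstance ρ) :=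
    D.le_sum_expectedCost D.factorial_mul_harmonic_le_sum_cost
  exact ⟨fun D => OnlineMatching.tau_le_competitiveRatio hn₀ (deterministic_bound D),
    fun _ _ A => OnlineMatching.tau_le_competitiveRatio hn₀
      (A.le_sum_expectedCost deterministic_bound)⟩
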